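/- Work over $\mathbb{C}$. For a positive integer $n$ let $\mathbb{F}_n=\mathbb{P}(\mathcal{O}_{\mathbb{P}^1}\oplus\mathcal{O}_{\mathbb{P}^1}(-n))$ be the Segre--Hirzebruch surface, where $\mathbb{P}(\mathcal V)$ denotes the projective bundle of hyperplanes (one-dimensional quotients) in $\mathcal V$; let $F$ be the class of a fibre of $\mathbb{F}_n\to\mathbb{P}^1$, let $C_0$ be the unique effective divisor with $C_0^2=-n$, and put $A=2C_0-F$. Let $$X=\mathbb{P}\big(\mathcal{O}_{\mathbb{F}_n}\oplus\mathcal{O}_{\mathbb{F}_n}(-2C_0+F)\big),\qquad \tau=c_1(\mathcal{O}_X(1)).$$ Let $R$ be the zero divisor of the section of $\mathcal{O}_X(\tau+A)$ that is unique up to scalars, let $U\subset X$ be the preimage of $C_0$, and let $\sigma=R\cap U$. Then there is an integer $N_0$ such that for every $n\ge N_0$ the following holds. The base locus of the bianticanonical linear system $|-2K_X|$ is the curve $\sigma$, and the generic member of $|-2K_X|$ has multiplicity exactly $3$ along $\sigma$; that is, there is a non-empty Zariski open subset of the projective space $|-2K_X|$ such that for every divisor $D$ in it, a local equation of $D$ lies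 in $\mathfrak{m}^3$ but not in $\mathfrak{m}^4$, where $\mathfrak{m}$ is the maximal ideal of the local ring $\mathcal{O}_{X,\sigma}$ of $X$ at the generic point of $\sigma$. -/

import Mathlib

open MvPolynomial LinearAlgebra.Projectivization Topology

noncomputable section

namespace Scroll

/-! ### Regular functions on Zariski open subsets of affine space -/

/-- `f` is a regular function on `V ⊆ 𝔸ᵈ(ℂ)`: around every point of `V` it is a quotient of two
polynomials, the denominator not vanishing at the point. -/
def RegularOn {d : ℕ} (V : Set (Fin d → ℂ)) (f : (Fin d → ℂ) → ℂ) : Prop :=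
  ∀ p ∈ V, ∃ P Q : MvPolynomial (Fin d) ℂ, eval p Q ≠ 0 ∧
    ∀ q ∈ V, eval q Q ≠ 0 → f q = eval q P / eval q Q

section RegularOn

variable {d : ℕ} {V : Set (Fin d → ℂ)} {f g : (Fin d → ℂ) → ℂ}

lemma RegularOn.poly (V : Set (Fin d → ℂ)) (P : MvPolynomial (Fin d) ℂ) :
    RegularOn V (fun p => eval p P) :=
  fun p _ => ⟨P, 1, by simp, fun q _ _ => by simp⟩

lemma RegularOn.const (V : Set (Fin d → ℂ)) (c : ℂ) : RegularOn V (fun _ => c) := by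
  simpa using RegularOn.poly V (C c)

lemma RegularOn.coord (V : Set (Fin d → ℂ)) (k : Fin d) : RegularOn V (fun p => p k) := by
  simpa using RegularOn.poly V (X k)

lemma RegularOn.congr (hf : RegularOn V f) (h : ∀ p ∈ V, g p = f p) : RegularOn V g := by
  intro p hp
  obtain ⟨P, Q, hQ, hPQ⟩ := hf p hp
  exact ⟨P, Q, hQ, fun q hq hq' => (h q hq).trans (hPQ q hq hq')⟩

lemma RegularOn.mono {W : Set (Fin d → ℂ)} (hf : RegularOn V f) (h : W ⊆ V) : RegularOn W f := by
  intro p hp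
  obtain ⟨P, Q, hQ, hPQ⟩ := hf p (h hp)
  exact ⟨P, Q, hQ, fun q hq hq' => hPQ q (h hq) hq'⟩

lemma RegularOn.add (hf : RegularOn V f) (hg : RegularOn V g) :
    RegularOn V (fun p => f p + g p) := by
  intro p hp
  obtain ⟨P, Q, hQ, hPQ⟩ := hf p hp
  obtain ⟨P', Q', hQ', hPQ'⟩ := hg p hp
  refine ⟨P * Q' + P' * Q, Q * Q', by simp [hQ, hQ'], fun q hq hqq => ?_⟩
  have h1 : eval q Q ≠ 0 := fun h => hqq (by simp [h])
  have h2 : eval q Q' ≠ 0 := fun h => hqq (by simp [h])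
  dsimp only
  rw [hPQ q hq h1, hPQ' q hq h2]
  simp only [map_add, map_mul]
  field_simp

lemma RegularOn.mul (hf : RegularOn V f) (hg : RegularOn V g) :
    RegularOn V (fun p => f p * g p) := by
  intro p hp
  obtain ⟨P, Q, hQ, hPQ⟩ := hf p hp
  obtain ⟨P', Q', hQ', hPQ'⟩ := hg p hp
  refine ⟨P * P', Q * Q', by simp [hQ, hQ'], fun q hq hqq => ?_⟩
  have h1 : eval q Q ≠ 0 := fun h => hqq (by simp [h])
  have h2 : eval q Q' ≠ 0 := fun h => hqq (by simp [h])
  dsimp only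
  rw [hPQ q hq h1, hPQ' q hq h2]
  simp only [map_mul]
  field_simp

lemma RegularOn.inv (hf : RegularOn V f) (h0 : ∀ p ∈ V, f p ≠ 0) :
    RegularOn V (fun p => (f p)⁻¹) := by
  intro p hp
  obtain ⟨P, Q, hQ, hPQ⟩ := hf p hp
  have hP : eval p P ≠ 0 := fun h => h0 p hp (by rw [hPQ p hp hQ, h, zero_div])
  refine ⟨Q * Q, P * Q, by simp [hQ, hP], fun q hq hqq => ?_⟩
  have h1 : eval q P ≠ 0 := fun h => hqq (by simp [h])
  have h2 : eval q Q ≠ 0 := fun h => hqq (by simp [h])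
  dsimp only
  rw [hPQ q hq h2]
  simp only [map_mul]
  field_simp

lemma RegularOn.pow (hf : RegularOn V f) (m : ℕ) : RegularOn V (fun p => f p ^ m) := by
  induction m with
  | zero => simpa using RegularOn.const V 1
  | succ m ih => simpa only [pow_succ] using ih.mul hf

lemma RegularOn.zpow (hf : RegularOn V f) (h0 : ∀ p ∈ V, f p ≠ 0) (m : ℤ) :
    RegularOn V (fun p => f p ^ m) := by
  cases m with
  | ofNat m => simpa using hf.pow m
  | negSucc m =>
    simpa only [zpow_negSucc] using (hf.pow (m + 1)).inv fun p hp => pow_ne_zero _ (h0 p hp)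

lemma RegularOn.sum {ι : Type*} (s : Finset ι) {F : ι → (Fin d → ℂ) → ℂ}
    (h : ∀ i ∈ s, RegularOn V (F i)) : RegularOn V (fun p => ∑ i ∈ s, F i p) := by
  classical
  induction s using Finset.induction_on with
  | empty => simpa using RegularOn.const V 0
  | insert a s ha ih =>
    simp only [Finset.sum_insert ha]
    exact (h a (by simp)).add (ih fun i hi => h i (by simp [hi]))

lemma RegularOn.prod {ι : Type*} (s : Finset ι) {F : ι → (Fin d → ℂ) → ℂ}
    (h : ∀ i ∈ s, RegularOn V (F i)) : RegularOn V (fun p => ∏ i ∈ s, F i p) := by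
  classical
  induction s using Finset.induction_on with
  | empty => simpa using RegularOn.const V 1
  | insert a s ha ih =>
    simp only [Finset.prod_insert ha]
    exact (h a (by simp)).mul (ih fun i hi => h i (by simp [hi]))

lemma RegularOn.comp_tail {V' : Set (Fin (d + 1) → ℂ)} (hf : RegularOn V f)
    (h : ∀ p ∈ V', Fin.tail p ∈ V) : RegularOn V' (fun p => f (Fin.tail p)) := by
  intro p hp
  obtain ⟨P, Q, hQ, hPQ⟩ := hf _ (h p hp)
  have key : ∀ (q : Fin (d + 1) → ℂ) (R : MvPolynomial (Fin d) ℂ),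
      eval q (rename Fin.succ R) = eval (Fin.tail q) R := fun q R => by
    rw [eval_rename]; rfl
  refine ⟨rename Fin.succ P, rename Fin.succ Q, by rwa [key], fun q hq hqq => ?_⟩
  rw [key] at hqq
  dsimp only
  rw [key, key, hPQ _ (h q hq) hqq]

lemma hasFDerivAt_eval (P : MvPolynomial (Fin d) ℂ) (p : Fin d → ℂ) :
    HasFDerivAt (fun q : Fin d → ℂ => eval q P)
      (∑ l, eval p (pderiv l P) • (ContinuousLinearMap.proj l : (Fin d → ℂ) →L[ℂ] ℂ)) p := by
  induction P using MvPolynomial.induction_on with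
  | C a =>
    simp only [eval_C]
    refine (hasFDerivAt_const (𝕜 := ℂ) a p).congr_fderiv ?_
    ext v
    simp
  | add P Q hP hQ =>
    simp only [map_add]
    refine (hP.fun_add hQ).congr_fderiv ?_
    ext v
    simp [add_mul, Finset.sum_add_distrib]
  | mul_X P i hP =>
    have hX : HasFDerivAt (fun q : Fin d → ℂ => q i)
      (ContinuousLinearMap.proj i : (Fin d → ℂ) →L[ℂ] ℂ) p :=
      (ContinuousLinearMap.proj i : (Fin d → ℂ) →L[ℂ] ℂ).hasFDerivAt
    simp only [map_mul, eval_X]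
    refine (hP.mul hX).congr_fderiv ?_
    ext v
    simp [Derivation.leibniz, pderiv_X, Pi.single_apply, add_mul,
      Finset.sum_add_distrib, Finset.mul_sum]
    congr 1
    · rw [Finset.sum_eq_single i] <;> simp +contextual [eq_comm]
    · exact Finset.sum_congr rfl fun _ _ => by ring

lemma hasFDerivAt_div (P Q : MvPolynomial (Fin d) ℂ) {p : Fin d → ℂ} (hQ : eval p Q ≠ 0) :
    HasFDerivAt (fun q : Fin d → ℂ => eval q P / eval q Q)
      (∑ l, (eval p (pderiv l P * Q - P * pderiv l Q) / eval p (Q * Q)) •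
        (ContinuousLinearMap.proj l : (Fin d → ℂ) →L[ℂ] ℂ)) p := by
  have h := (hasFDerivAt_eval P p).mul ((hasDerivAt_inv hQ).comp_hasFDerivAt p (hasFDerivAt_eval Q p))
  simp only [div_eq_mul_inv (eval _ P)]
  refine h.congr_fderiv ?_
  ext v
  simp [Finset.mul_sum]
  rw [← Finset.sum_neg_distrib, ← Finset.sum_add_distrib]
  refine Finset.sum_congr rfl fun l _ => ?_
  field_simp
  ring

lemma RegularOn.eventuallyEq (hV : IsOpen V) {P Q : MvPolynomial (Fin d) ℂ}
    (h : ∀ q ∈ V, eval q Q ≠ 0 → f q = eval q P / eval q Q) {q : Fin d → ℂ} (hq : q ∈ V)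
    (hQ : eval q Q ≠ 0) : f =ᶠ[𝓝 q] fun q => eval q P / eval q Q := by
  have h2 : IsOpen {q : Fin d → ℂ | eval q Q ≠ 0} :=
    isOpen_ne_fun (MvPolynomial.continuous_eval Q) continuous_const
  filter_upwards [hV.mem_nhds hq, h2.mem_nhds hQ] with x hx hx'
  exact h x hx hx'

lemma RegularOn.differentiableAt (hf : RegularOn V f) (hV : IsOpen V) {p : Fin d → ℂ}
    (hp : p ∈ V) : DifferentiableAt ℂ f p := by
  obtain ⟨P, Q, hQ, hPQ⟩ := hf p hp
  refine DifferentiableAt.congr_of_eventuallyEq ?_ (RegularOn.eventuallyEq hV hPQ hp hQ)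
  exact (hasFDerivAt_div P Q hQ).differentiableAt

lemma RegularOn.partialDeriv (hf : RegularOn V f) (hV : IsOpen V) (l : Fin d) :
    RegularOn V (fun p => fderiv ℂ f p (Pi.single l 1)) := by
  intro p hp
  obtain ⟨P, Q, hQ, hPQ⟩ := hf p hp
  refine ⟨pderiv l P * Q - P * pderiv l Q, Q * Q, by simp [hQ], fun q hq hqq => ?_⟩
  have hQ' : eval q Q ≠ 0 := fun h => hqq (by simp [h])
  dsimp only
  rw [(RegularOn.eventuallyEq hV hPQ hq hQ').fderiv_eq]
  rw [(hasFDerivAt_div P Q hQ').fderiv]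
  simp [Pi.single_apply]

lemma RegularOn.det_fderiv {F : (Fin d → ℂ) → (Fin d → ℂ)}
    (hF : ∀ k, RegularOn V (fun p => F p k)) (hV : IsOpen V) :
    RegularOn V (fun p => (fderiv ℂ F p).det) := by
  have hdet : ∀ p ∈ V, (fderiv ℂ F p).det =
      ∑ σ : Equiv.Perm (Fin d), ((Equiv.Perm.sign σ : ℤ) : ℂ) *
        ∏ l, fderiv ℂ (fun p => F p (σ l)) p (Pi.single l 1) := by
    intro p hp
    have hd : ∀ k, DifferentiableAt ℂ (fun p => F p k) p :=
      fun k => (hF k).differentiableAt hV hp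
    have h1 : ∀ k v, fderiv ℂ F p v k = fderiv ℂ (fun p => F p k) p v := by
      intro k v
      rw [fderiv_pi hd]; rfl
    rw [ContinuousLinearMap.det, ← LinearMap.det_toMatrix', Matrix.det_apply']
    refine Finset.sum_congr rfl fun σ _ => ?_
    congr 1
    refine Finset.prod_congr rfl fun l _ => ?_
    rw [← h1, LinearMap.toMatrix'_apply]
    rfl
  refine RegularOn.congr (RegularOn.sum _ fun σ _ => ?_) hdet
  exact (RegularOn.const V _).mul (RegularOn.prod _ fun l _ => (hF (σ l)).partialDeriv hV l)

end RegularOn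

/-! ### Varieties glued from affine spaces -/

/-- A smooth complex variety of dimension `d` glued from finitely many copies `Uᵢ` of the affine
space `𝔸ᵈ`. The part of `Uᵢ` that also lies in `Uⱼ` is the principal Zariski open set `V i j`, and
`φ i j` is the change of coordinates from `Uᵢ` to `Uⱼ`, which only matters on `V i j`. -/
structure GluedVariety (d : ℕ) where
  ι : Type
  finite : Finite ι
  V : ι → ι → Set (Fin d → ℂ)
  φ : ι → ι → (Fin d → ℂ) → (Fin d → ℂ)
  principal : ∀ i j, ∃ h : MvPolynomial (Fin d) ℂ, V i j = {p | eval p h ≠ 0}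
  regular : ∀ i j k, RegularOn (V i j) (fun p => φ i j p k)
  V_self : ∀ i, V i i = Set.univ
  φ_self : ∀ i p, φ i i p = p
  mapsTo : ∀ i j p, p ∈ V i j → φ i j p ∈ V j i
  trans_mem : ∀ i j k p, p ∈ V i j → φ i j p ∈ V j k → p ∈ V i k
  trans_eq : ∀ i j k p, p ∈ V i j → φ i j p ∈ V j k → φ j k (φ i j p) = φ i k p

namespace GluedVariety

variable {d : ℕ} (A : GluedVariety d)

lemma isOpen_V (i j : A.ι) : IsOpen (A.V i j) := by
  obtain ⟨h, hh⟩ := A.principal i j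
  rw [hh]
  exact isOpen_ne_fun (MvPolynomial.continuous_eval h) continuous_const

lemma φ_φ {i j : A.ι} {p : Fin d → ℂ} (hp : p ∈ A.V i j) : A.φ j i (A.φ i j p) = p := by
  rw [A.trans_eq i j i p hp (A.mapsTo i j p hp), A.φ_self]

/-- Two points in charts are identified when the change of coordinates maps one to the other. -/
def setoid : Setoid (A.ι × (Fin d → ℂ)) where
  r x y := x.2 ∈ A.V x.1 y.1 ∧ A.φ x.1 y.1 x.2 = y.2
  iseqv :=
    { refl := fun x => ⟨by rw [A.V_self]; trivial, A.φ_self _ _⟩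
      symm := by
        rintro ⟨i, p⟩ ⟨j, q⟩ ⟨h, h1⟩
        dsimp only at h h1
        subst h1
        exact ⟨A.mapsTo i j p h, A.φ_φ h⟩
      trans := by
        rintro ⟨i, p⟩ ⟨j, q⟩ ⟨k, r⟩ ⟨h, h1⟩ ⟨h', h1'⟩
        dsimp only at h h1 h' h1'
        subst h1 h1'
        exact ⟨A.trans_mem i j k p h h', (A.trans_eq i j k p h h').symm⟩ }

/-- The set of (closed) points of the variety. -/
def Point : Type := Quotient A.setoid

/-- The inclusion of the affine chart `Uᵢ`. -/
def chart (i : A.ι) (p : Fin d → ℂ) : A.Point := Quotient.mk A.setoid (i, p)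

end GluedVariety

/-! ### Line bundles, their sections, and the canonical bundle -/

/-- An algebraic line bundle, trivialised over every chart, given by its cocycle: the coordinate
functions of a section over two charts are related by `sⱼ ∘ φ i j = g i j * sᵢ` on `V i j`. -/
structure LineBundle {d : ℕ} (A : GluedVariety d) where
  g : A.ι → A.ι → (Fin d → ℂ) → ℂ
  regular : ∀ i j, RegularOn (A.V i j) (g i j)
  ne_zero : ∀ i j p, p ∈ A.V i j → g i j p ≠ 0
  cocycle : ∀ i j k p, p ∈ A.V i j → A.φ i j p ∈ A.V j k →
    g j k (A.φ i j p) * g i j p = g i k p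

namespace LineBundle

variable {d : ℕ} {A : GluedVariety d}

lemma g_symm (L : LineBundle A) {i j : A.ι} {p : Fin d → ℂ} (hp : p ∈ A.V i j) :
    L.g j i (A.φ i j p) = (L.g i j p)⁻¹ := by
  have hii : p ∈ A.V i i := by rw [A.V_self]; trivial
  have h1 : L.g i i p = 1 := by
    have h := L.cocycle i i i p hii (by rw [A.V_self]; trivial)
    rw [A.φ_self] at h
    exact mul_left_cancel₀ (L.ne_zero i i p hii) (by rw [h, mul_one])
  have h := L.cocycle i j i p hp (A.mapsTo i j p hp)
  rw [h1] at h
  exact eq_inv_of_mul_eq_one_left h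

/-- The structure sheaf `𝒪`. -/
def trivial (A : GluedVariety d) : LineBundle A where
  g _ _ _ := 1
  regular _ _ := RegularOn.const _ 1
  ne_zero _ _ _ _ := one_ne_zero
  cocycle _ _ _ _ _ _ := one_mul 1

/-- The tensor product `L ⊗ M`. -/
def tensor (L M : LineBundle A) : LineBundle A where
  g i j p := L.g i j p * M.g i j p
  regular i j := (L.regular i j).mul (M.regular i j)
  ne_zero i j p hp := mul_ne_zero (L.ne_zero i j p hp) (M.ne_zero i j p hp)
  cocycle i j k p h h' := by
    rw [← L.cocycle i j k p h h', ← M.cocycle i j k p h h']; ring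

/-- The tensor power `L^{⊗ m}` for an integer `m` (for `m < 0` a power of the dual). -/
def power (L : LineBundle A) (m : ℤ) : LineBundle A where
  g i j p := L.g i j p ^ m
  regular i j := (L.regular i j).zpow (L.ne_zero i j) m
  ne_zero i j p hp := zpow_ne_zero m (L.ne_zero i j p hp)
  cocycle i j k p h h' := by
    rw [← L.cocycle i j k p h h', mul_zpow]

/-- The space of global sections `H⁰(L)`: a section is a regular function, that is a polynomial,
on every chart, compatible with the cocycle. -/
def H0 (L : LineBundle A) : Submodule ℂ (A.ι → MvPolynomial (Fin d) ℂ) where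
  carrier := {s | ∀ i j, ∀ p ∈ A.V i j, eval (A.φ i j p) (s j) = L.g i j p * eval p (s i)}
  zero_mem' i j p _ := by simp
  add_mem' {s t} hs ht i j p hp := by simp [hs i j p hp, ht i j p hp, mul_add]
  smul_mem' c s hs i j p hp := by simp [hs i j p hp]; ring

/-- The set of zeros of a section. -/
def zeros {L : LineBundle A} (s : L.H0) : Set A.Point :=
  {x | ∃ i p, x = A.chart i p ∧ eval p (s.1 i) = 0}

/-- The base locus of the complete linear system `|L|`. -/
def baseLocus (L : LineBundle A) : Set A.Point :=
  {x | ∀ s : L.H0, x ∈ zeros s}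

/-- The complete linear system `|L|`: the projective space of lines in `H⁰(L)`, an element being
identified with the divisor of zeros of the nonzero sections on that line. -/
abbrev LinearSystem (L : LineBundle A) : Type := ℙ ℂ L.H0

/-- `Z` is non-empty, has a prime vanishing ideal on each chart `Uᵢ` that it meets, and there the local
equation of the divisor of `s` lies in the `m`-th, but not in the `(m+1)`-st, power of the maximal
ideal of the local ring `𝒪_{X,Z}` at the generic point of `Z`: the divisor of `s` has multiplicity
exactly `m` along the subvariety `Z`. -/
def HasMultiplicityAlong {L : LineBundle A} (s : L.H0) (Z : Set A.Point) (m : ℕ) : Prop :=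
  Z.Nonempty ∧ ∀ i, (A.chart i ⁻¹' Z).Nonempty →
    ∃ _ : (vanishingIdeal ℂ (A.chart i ⁻¹' Z)).IsPrime,
      algebraMap _ (Localization.AtPrime (vanishingIdeal ℂ (A.chart i ⁻¹' Z))) (s.1 i) ∈
        IsLocalRing.maximalIdeal
          (Localization.AtPrime (vanishingIdeal ℂ (A.chart i ⁻¹' Z))) ^ m ∧
      algebraMap _ (Localization.AtPrime (vanishingIdeal ℂ (A.chart i ⁻¹' Z))) (s.1 i) ∉
        IsLocalRing.maximalIdeal
          (Localization.AtPrime (vanishingIdeal ℂ (A.chart i ⁻¹' Z))) ^ (m + 1)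

lemma fderiv_comp_φ (A : GluedVariety d) {i j k : A.ι} {p : Fin d → ℂ} (hp : p ∈ A.V i j)
    (hp' : A.φ i j p ∈ A.V j k) :
    (fderiv ℂ (A.φ j k) (A.φ i j p)).comp (fderiv ℂ (A.φ i j) p) = fderiv ℂ (A.φ i k) p := by
  have hd : ∀ {a b : A.ι} {q : Fin d → ℂ}, q ∈ A.V a b → DifferentiableAt ℂ (A.φ a b) q :=
    fun {a b q} hq => differentiableAt_pi.2 fun l =>
      (A.regular a b l).differentiableAt (A.isOpen_V a b) hq
  rw [← fderiv_comp p (hd hp') (hd hp)]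
  refine Filter.EventuallyEq.fderiv_eq ?_
  filter_upwards [(A.isOpen_V i j).mem_nhds hp,
    (hd hp).continuousAt.preimage_mem_nhds ((A.isOpen_V j k).mem_nhds hp')] with q hq hq'
  exact A.trans_eq i j k q hq hq'

lemma det_fderiv_comp (A : GluedVariety d) {i j k : A.ι} {p : Fin d → ℂ} (hp : p ∈ A.V i j)
    (hp' : A.φ i j p ∈ A.V j k) :
    (fderiv ℂ (A.φ j k) (A.φ i j p)).det * (fderiv ℂ (A.φ i j) p).det =
      (fderiv ℂ (A.φ i k) p).det := by
  rw [← fderiv_comp_φ A hp hp']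
  exact (LinearMap.det_comp _ _).symm

lemma det_fderiv_ne_zero (A : GluedVariety d) {i j : A.ι} {p : Fin d → ℂ} (hp : p ∈ A.V i j) :
    (fderiv ℂ (A.φ i j) p).det ≠ 0 := by
  have h := det_fderiv_comp A hp (A.mapsTo i j p hp)
  have h1 : A.φ i i = id := funext (A.φ_self i)
  rw [h1, fderiv_id] at h
  have h2 : (ContinuousLinearMap.id ℂ (Fin d → ℂ)).det = 1 := LinearMap.det_id
  rw [h2] at h
  exact right_ne_zero_of_mul_eq_one h

/-- The canonical bundle `𝒪(K) = Ω^d`, trivialised on every chart by `dx₁ ∧ ⋯ ∧ dx_d`: as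
`dy₁ ∧ ⋯ ∧ dy_d = J dx₁ ∧ ⋯ ∧ dx_d` for `y = φ i j x` with Jacobian determinant `J`, the cocycle
is `J⁻¹`. -/
def canonical (A : GluedVariety d) : LineBundle A where
  g i j p := ((fderiv ℂ (A.φ i j) p).det)⁻¹
  regular i j := (RegularOn.det_fderiv (A.regular i j) (A.isOpen_V i j)).inv
    fun _ hp => det_fderiv_ne_zero A hp
  ne_zero _ _ _ hp := inv_ne_zero (det_fderiv_ne_zero A hp)
  cocycle i j k p h h' := by rw [← det_fderiv_comp A h h', mul_inv]

end LineBundle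

/-! ### The projective bundle `ℙ(𝒪 ⊕ L)` -/

/-- The change of the affine fibre coordinate of `ℙ(𝒪 ⊕ L)`. Over `Uᵢ` let `a₀, a₁` be the
homogeneous fibre coordinates defined by the local frame `1, eᵢ` of `𝒪 ⊕ L`. On the chart
`false` the fibre coordinate is `w = a₁ / a₀`, and on the chart `true` it is `w = a₀ / a₁`. As
`eᵢ = g eⱼ`, passing from `Uᵢ` to `Uⱼ` replaces `(a₀, a₁)` by `(a₀, g⁻¹ a₁)`. -/
def fibreChange (g : ℂ) : Bool → Bool → ℂ → ℂ
  | false, false, w => g⁻¹ * w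
  | false, true, w => g * w⁻¹
  | true, false, w => g⁻¹ * w⁻¹
  | true, true, w => g * w

variable {d : ℕ} {A : GluedVariety d}

/-- The projective bundle `ℙ(𝒪 ⊕ L)` of hyperplanes (that is, of one-dimensional quotients of the
fibres) of the rank two bundle `𝒪 ⊕ L`. Coordinate `0` of a chart is the fibre coordinate, and
the remaining ones are the coordinates on the base. -/
def projBundle (L : LineBundle A) : GluedVariety (d + 1) where
  ι := A.ι × Bool
  finite := haveI := A.finite; inferInstance
  V x y := {p | Fin.tail p ∈ A.V x.1 y.1 ∧ (x.2 ≠ y.2 → p 0 ≠ 0)}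
  φ x y p := Fin.cons (fibreChange (L.g x.1 y.1 (Fin.tail p)) x.2 y.2 (p 0))
    (A.φ x.1 y.1 (Fin.tail p))
  principal := by
    rintro ⟨i, a⟩ ⟨j, b⟩
    obtain ⟨h, hh⟩ := A.principal i j
    have key : ∀ q : Fin (d + 1) → ℂ,
        eval q (rename Fin.succ h) = eval (Fin.tail q) h := fun q => by rw [eval_rename]; rfl
    by_cases hab : a = b
    · exact ⟨rename Fin.succ h, by ext p; simp [hh, key, hab]⟩
    · exact ⟨rename Fin.succ h * X 0, by ext p; simp [hh, key, hab]⟩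
  regular := by
    rintro ⟨i, a⟩ ⟨j, b⟩ k
    refine Fin.cases ?_ (fun k => ?_) k
    · simp only [Fin.cons_zero]
      have hg := (L.regular i j).comp_tail
        (V' := {p | Fin.tail p ∈ A.V i j ∧ (a ≠ b → p 0 ≠ 0)}) fun p hp => hp.1
      have hg' := hg.inv fun p hp => L.ne_zero i j _ hp.1
      have hw := RegularOn.coord {p | Fin.tail p ∈ A.V i j ∧ (a ≠ b → p 0 ≠ 0)} 0
      cases a <;> cases b
      · exact hg'.mul hw
      · exact hg.mul (hw.inv fun p hp => hp.2 (by simp))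
      · exact hg'.mul (hw.inv fun p hp => hp.2 (by simp))
      · exact hg.mul hw
    · simp only [Fin.cons_succ]
      exact (A.regular i j k).comp_tail fun p hp => hp.1
  V_self x := by ext p; simp [A.V_self]
  φ_self := by
    rintro ⟨i, a⟩ p
    have hp : Fin.tail p ∈ A.V i i := by rw [A.V_self]; trivial
    have h1 : L.g i i (Fin.tail p) = 1 := by
      have h := L.cocycle i i i _ hp (by rw [A.V_self]; trivial)
      rw [A.φ_self] at h
      exact mul_left_cancel₀ (L.ne_zero i i _ hp) (by rw [h, mul_one])
    have h2 : fibreChange 1 a a (p 0) = p 0 := by cases a <;> simp [fibreChange]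
    simp only [h1, h2, A.φ_self]
    exact Fin.cons_self_tail p
  mapsTo := by
    rintro ⟨i, a⟩ ⟨j, b⟩ p ⟨h, h0⟩
    refine ⟨by simpa using A.mapsTo i j _ h, fun hab => ?_⟩
    have := L.ne_zero i j _ h
    have := h0 (Ne.symm hab)
    cases a <;> cases b <;> simp_all [fibreChange]
  trans_mem := by
    rintro ⟨i, a⟩ ⟨j, b⟩ ⟨k, c⟩ p ⟨h, h0⟩ ⟨h', h0'⟩
    simp only [Fin.tail_cons, Fin.cons_zero] at h' h0'
    refine ⟨A.trans_mem i j k _ h h', fun hac => ?_⟩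
    cases a <;> cases b <;> cases c <;> simp_all [fibreChange]
  trans_eq := by
    rintro ⟨i, a⟩ ⟨j, b⟩ ⟨k, c⟩ p ⟨h, h0⟩ ⟨h', h0'⟩
    simp only [Fin.tail_cons, Fin.cons_zero] at h' h0' ⊢
    rw [A.trans_eq i j k _ h h', ← L.cocycle i j k _ h h']
    congr 1
    have h1 := L.ne_zero i j _ h
    have h2 := L.ne_zero j k _ h'
    cases a <;> cases b <;> cases c <;> simp_all [fibreChange] <;> field_simp

/-- The pull-back of a line bundle along the bundle projection `ℙ(𝒪 ⊕ L) → A`. -/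
def pullback (L M : LineBundle A) : LineBundle (projBundle L) where
  g x y p := M.g x.1 y.1 (Fin.tail p)
  regular x y := (M.regular x.1 y.1).comp_tail fun _ hp => hp.1
  ne_zero x y p hp := M.ne_zero x.1 y.1 _ hp.1
  cocycle x y z p hp hp' := M.cocycle x.1 y.1 z.1 _ hp.1 hp'.1

/-- The cocycle of the tautological quotient bundle `𝒪(1)` of `ℙ(𝒪 ⊕ L)`, trivialised by `a₀` on
the charts `false` and by `a₁` on the charts `true`. -/
def tautCocycle (g : ℂ) : Bool → Bool → ℂ → ℂ
  | false, false, _ => 1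
  | false, true, w => g * w⁻¹
  | true, false, w => w⁻¹
  | true, true, _ => g

/-- The tautological quotient bundle `𝒪(1)` on `ℙ(𝒪 ⊕ L)`, with class `τ`. -/
def taut (L : LineBundle A) : LineBundle (projBundle L) where
  g x y p := tautCocycle (L.g x.1 y.1 (Fin.tail p)) x.2 y.2 (p 0)
  regular := by
    rintro ⟨i, a⟩ ⟨j, b⟩
    have hg := (L.regular i j).comp_tail
      (V' := {p | Fin.tail p ∈ A.V i j ∧ (a ≠ b → p 0 ≠ 0)}) fun p hp => hp.1
    have hw := RegularOn.coord {p | Fin.tail p ∈ A.V i j ∧ (a ≠ b → p 0 ≠ 0)} 0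
    cases a <;> cases b
    · exact RegularOn.const _ 1
    · exact hg.mul (hw.inv fun p hp => hp.2 (by simp))
    · exact hw.inv fun p hp => hp.2 (by simp)
    · exact hg
  ne_zero := by
    rintro ⟨i, a⟩ ⟨j, b⟩ p ⟨h, h0⟩
    have := L.ne_zero i j _ h
    cases a <;> cases b <;> simp_all [tautCocycle]
  cocycle := by
    rintro ⟨i, a⟩ ⟨j, b⟩ ⟨k, c⟩ p ⟨h, h0⟩ ⟨h', h0'⟩
    have e1 : Fin.tail ((projBundle L).φ (i, a) (j, b) p) = A.φ i j (Fin.tail p) := rfl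
    have e2 : (projBundle L).φ (i, a) (j, b) p 0 =
      fibreChange (L.g i j (Fin.tail p)) a b (p 0) := rfl
    simp only [e1, e2] at h' h0' ⊢
    rw [← L.cocycle i j k _ h h']
    have h1 := L.ne_zero i j _ h
    have h2 := L.ne_zero j k _ h'
    cases a <;> cases b <;> cases c <;> simp_all [fibreChange, tautCocycle] <;> field_simp

/-- The section of `𝒪(1)` on `ℙ(𝒪 ⊕ L)` given by the constant section `1` of the summand `𝒪`; in
fibre coordinates it is `a₀`. -/
def sectionT (L : LineBundle A) : (taut L).H0 where
  val x := if x.2 then X 0 else 1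
  property := by
    rintro ⟨i, a⟩ ⟨j, b⟩ p ⟨h, h0⟩
    have e2 : (projBundle L).φ (i, a) (j, b) p 0 =
      fibreChange (L.g i j (Fin.tail p)) a b (p 0) := rfl
    have h1 := L.ne_zero i j _ h
    cases a <;> cases b <;> simp_all [fibreChange, tautCocycle, taut]

/-- The section of `𝒪(1) ⊗ L⁻¹` on `ℙ(𝒪 ⊕ L)` given by the constant section `1` of the summand
`𝒪 = L ⊗ L⁻¹` of `(𝒪 ⊕ L) ⊗ L⁻¹`; in fibre coordinates it is `a₁`. -/
def sectionR (L : LineBundle A) : ((taut L).tensor (pullback L (L.power (-1)))).H0 where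
  val x := if x.2 then 1 else X 0
  property := by
    rintro ⟨i, a⟩ ⟨j, b⟩ p ⟨h, h0⟩
    have e2 : (projBundle L).φ (i, a) (j, b) p 0 =
      fibreChange (L.g i j (Fin.tail p)) a b (p 0) := rfl
    have h1 := L.ne_zero i j _ h
    cases a <;> cases b <;>
      simp_all [fibreChange, tautCocycle, taut, LineBundle.tensor, LineBundle.power, pullback] <;>
      field_simp

/-- The pull-back of a section along the bundle projection `ℙ(𝒪 ⊕ L) → A`. -/
def pullbackSection (L : LineBundle A) {M : LineBundle A} (s : M.H0) : (pullback L M).H0 where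
  val x := rename Fin.succ (s.1 x.1)
  property := by
    rintro ⟨i, a⟩ ⟨j, b⟩ p ⟨h, h0⟩
    rw [eval_rename, eval_rename]
    exact s.2 i j _ h

/-! ### The projective line, the Segre–Hirzebruch surface, and the threefold -/

/-- The variety consisting of a single point. -/
def point : GluedVariety 0 where
  ι := Unit
  finite := inferInstance
  V _ _ := Set.univ
  φ _ _ p := p
  principal _ _ := ⟨1, by simp⟩
  regular _ _ k := k.elim0
  V_self _ := rfl
  φ_self _ _ := rfl
  mapsTo _ _ _ _ := trivial
  trans_mem _ _ _ _ _ _ := trivial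
  trans_eq _ _ _ _ _ _ := rfl

/-- The projective line `ℙ¹ = ℙ(𝒪 ⊕ 𝒪)` over a point. -/
def P1 : GluedVariety 1 := projBundle (LineBundle.trivial point)

/-- The line bundle `𝒪(m)` on `ℙ¹`. -/
def P1.O (m : ℤ) : LineBundle P1 := (taut (LineBundle.trivial point)).power m

/-- The Segre–Hirzebruch surface `𝔽ₙ = ℙ(𝒪 ⊕ 𝒪(-n))` over `ℙ¹`. -/
def Hirzebruch (n : ℕ) : GluedVariety 2 := projBundle (P1.O (-n))

namespace Hirzebruch

/-- The line bundle `𝒪(C₀)` of the negative section: `C₀` is the zero divisor of the section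
`sectionT` of the tautological bundle of `ℙ(𝒪 ⊕ 𝒪(-n))`, whose self-intersection is `-n`. -/
def OC0 (n : ℕ) : LineBundle (Hirzebruch n) := taut (P1.O (-n))

/-- The line bundle `𝒪(F)` of a fibre of `𝔽ₙ → ℙ¹`. -/
def OF (n : ℕ) : LineBundle (Hirzebruch n) := pullback (P1.O (-n)) (P1.O 1)

/-- The section of `𝒪(C₀)` that cuts out `C₀`. -/
def sectionC0 (n : ℕ) : (OC0 n).H0 := sectionT (P1.O (-n))

/-- The line bundle `𝒪(-A) = 𝒪(-2C₀ + F)`. -/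
def OnegA (n : ℕ) : LineBundle (Hirzebruch n) := ((OC0 n).power (-2)).tensor (OF n)

end Hirzebruch

/-- The threefold `X = ℙ(𝒪 ⊕ 𝒪(-2C₀ + F))` over `𝔽ₙ`. -/
def threefold (n : ℕ) : GluedVariety 3 := projBundle (Hirzebruch.OnegA n)

/-- The line bundle `𝒪(-2K_X)` on the threefold. -/
def bianticanonical (n : ℕ) : LineBundle (threefold n) :=
  (LineBundle.canonical (threefold n)).power (-2)

/-- The surface `R`, the zero locus of the section of `𝒪(τ + A)`. -/
def surfaceR (n : ℕ) : Set (threefold n).Point :=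
  LineBundle.zeros (sectionR (Hirzebruch.OnegA n))

/-- The surface `U`, the preimage of `C₀` in the threefold. -/
def surfaceU (n : ℕ) : Set (threefold n).Point :=
  LineBundle.zeros (pullbackSection (Hirzebruch.OnegA n) (Hirzebruch.sectionC0 n))

/-- The curve `σ = R ∩ U`. -/
def sigma (n : ℕ) : Set (threefold n).Point := surfaceR n ∩ surfaceU n

/-! ### Generic members -/

/-- Zariski open subsets of the projective space of lines in a complex vector space `W`: unions of
sets of the form `{F ≠ 0}` with `F` a homogeneous polynomial in linear forms on `W`. -/
def IsZariskiOpen {W : Type*} [AddCommGroup W] [Module ℂ W] (U : Set (ℙ ℂ W)) : Prop :=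
  ∃ S : Set (MvPolynomial (Module.Dual ℂ W) ℂ), (∀ F ∈ S, ∃ m, F.IsHomogeneous m) ∧
    U = {D | ∃ F ∈ S, eval (fun ℓ => ℓ D.rep) F ≠ 0}

/-- The property `P` holds for the generic element of a projective space: it holds on a non-empty
Zariski open subset. -/
def ForGeneric {W : Type*} [AddCommGroup W] [Module ℂ W] (P : ℙ ℂ W → Prop) : Prop :=
  ∃ U : Set (ℙ ℂ W), U.Nonempty ∧ IsZariskiOpen U ∧ ∀ D ∈ U, P D

end Scroll

end

/-!
The threefold `X` is toric, and so is every step of the argument. Applying the formula for the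
canonical bundle of a projective bundle (`canonical_projBundle_sq`) to `X → 𝔽ₙ → ℙ¹ → pt` gives
`-2K = 4τ + 8C₀ + (2n + 2)F` (`bianticanonical_g`). Write `a₀, a₁`, `v₀, v₁` and `u₀, u₁` for the
homogeneous fibre coordinates of the three bundles. Then the monomials `a₀ⁱ a₁ʲ v₀ᵏ v₁ˡ u₀ʳ u₁^q`
with `i + j = 4`, `k + l = 8 - 2j` and `r + q = 2n + 2 + j - nl` are sections of `𝒪(-2K)`
(`monomialSection`), and the curve `σ` is `a₁ = v₀ = 0`.

For `n ≥ 3`, a monomial of order `j + k ≤ 2` along `σ` has `l = 8 - 2j - k ≥ 4`, which makes `r + q`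
negative. Hence every section vanishes to order at least `3` along `σ` (`coeff_section_eq_zero`).
That an arbitrary section contains no such monomial is seen by comparing two opposite charts on their common
torus, where distinct characters are linearly independent (`exists_exponent_of_eq_on_torus`).
Conversely the monomials `a₀⁴ v₀⁸`, `a₁⁴` and `a₀⁴ v₀⁶ v₁²`, times powers of `u₀` or `u₁`, have no
common zero outside `σ` (`baseLocus_eq_sigma`).

The multiplicity is exactly `3` as soon as the coefficient of `x₀³` in the local equation is not zero
in both charts that meet `σ` (`multiplicity_line`, `hasMultiplicityAlong_sigma`). This is an open
condition, and `a₀ a₁³ v₁² (u₀⁵ + u₁⁵)` satisfies it. To exclude membership in the fourth power of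
the maximal ideal of the local ring, restrict to the plane `x₁ = 0` and count powers of `x₀`.
-/

noncomputable section

namespace Scroll

/-! ### The canonical bundle of a projective bundle -/

/-- The relative canonical bundle of `ℙ(𝒪 ⊕ L)` is `-2τ + L`, up to the sign `ε` of the cocycle. -/
lemma hasDerivAt_fibreChange (g : ℂ) (a b : Bool) {w : ℂ} (hw : a ≠ b → w ≠ 0) (hg : g ≠ 0) :
    ∃ ε : ℂ, ε ^ 2 = 1 ∧
      HasDerivAt (fibreChange g a b) (ε * (tautCocycle g a b w ^ 2 * g⁻¹)) w := by
  cases a <;> cases b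
  · refine ⟨1, by norm_num, ?_⟩
    refine ((hasDerivAt_id w).const_mul g⁻¹).congr_deriv ?_
    simp [tautCocycle]
  · have hw := hw (by simp)
    refine ⟨-1, by norm_num, ((hasDerivAt_inv hw).const_mul g).congr_deriv ?_⟩
    simp only [tautCocycle]
    field_simp
  · have hw := hw (by simp)
    refine ⟨-1, by norm_num, ((hasDerivAt_inv hw).const_mul g⁻¹).congr_deriv ?_⟩
    simp only [tautCocycle]
    field_simp
  · refine ⟨1, by norm_num, ((hasDerivAt_id w).const_mul g).congr_deriv ?_⟩
    simp only [tautCocycle]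
    field_simp

section Jacobian

variable {d : ℕ} {A : GluedVariety d}

lemma GluedVariety.differentiableAt_φ (A : GluedVariety d) {i j : A.ι} {p : Fin d → ℂ}
    (hp : p ∈ A.V i j) (k : Fin d) : DifferentiableAt ℂ (fun q => A.φ i j q k) p :=
  (A.regular i j k).differentiableAt (A.isOpen_V i j) hp

/-- The Jacobian matrix of a change of charts of `ℙ(𝒪 ⊕ L)` is block triangular, since the base
coordinates do not depend on the fibre coordinate. -/
lemma det_fderiv_projBundle (L : LineBundle A) (x y : (projBundle L).ι) {p : Fin (d + 1) → ℂ}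
    (hp : p ∈ (projBundle L).V x y) :
    (fderiv ℂ ((projBundle L).φ x y) p).det =
      deriv (fibreChange (L.g x.1 y.1 (Fin.tail p)) x.2 y.2) (p 0) *
        (fderiv ℂ (A.φ x.1 y.1) (Fin.tail p)).det := by
  have hd := fun k => (projBundle L).differentiableAt_φ hp k
  have hdA := fun k => A.differentiableAt_φ hp.1 k
  have hline : HasDerivAt (fun t : ℂ => (Fin.cons t (Fin.tail p) : Fin (d + 1) → ℂ))
      (Pi.single 0 1) (p 0) := by
    rw [hasDerivAt_pi]
    intro k
    refine Fin.cases ?_ (fun k => ?_) k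
    · simpa using hasDerivAt_id' (p 0)
    · simpa using hasDerivAt_const (p 0) (Fin.tail p k)
  have h00 : fderiv ℂ (fun q => (projBundle L).φ x y q 0) p (Pi.single 0 1) =
      deriv (fibreChange (L.g x.1 y.1 (Fin.tail p)) x.2 y.2) (p 0) := by
    have h := (hd 0).hasFDerivAt
    rw [show p = Fin.cons (p 0) (Fin.tail p) from (Fin.cons_self_tail p).symm] at h
    have h' := (h.comp_hasDerivAt (p 0) hline).deriv
    rw [Fin.cons_self_tail] at h'
    rw [← h']
    rfl
  let T : (Fin (d + 1) → ℂ) →L[ℂ] (Fin d → ℂ) :=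
    ContinuousLinearMap.pi fun k => ContinuousLinearMap.proj k.succ
  have hs : ∀ (k : Fin d) (v : Fin (d + 1) → ℂ),
      fderiv ℂ (fun q => (projBundle L).φ x y q k.succ) p v =
        fderiv ℂ (fun q => A.φ x.1 y.1 q k) (Fin.tail p) (Fin.tail v) := by
    intro k v
    have h : HasFDerivAt ((fun q => A.φ x.1 y.1 q k) ∘ T) _ p :=
      HasFDerivAt.comp p (hdA k).hasFDerivAt T.hasFDerivAt
    exact congrArg (fun f : (Fin (d + 1) → ℂ) →L[ℂ] ℂ => f v) h.fderiv
  have hX : ∀ k l, LinearMap.toMatrix' (fderiv ℂ ((projBundle L).φ x y) p).toLinearMap k l =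
      fderiv ℂ (fun q => (projBundle L).φ x y q k) p (Pi.single l 1) := by
    intro k l
    rw [LinearMap.toMatrix'_apply, ContinuousLinearMap.coe_coe, fderiv_pi hd]
    rfl
  have hA : ∀ k l, LinearMap.toMatrix' (fderiv ℂ (A.φ x.1 y.1) (Fin.tail p)).toLinearMap k l =
      fderiv ℂ (fun q => A.φ x.1 y.1 q k) (Fin.tail p) (Pi.single l 1) := by
    intro k l
    rw [LinearMap.toMatrix'_apply, ContinuousLinearMap.coe_coe, fderiv_pi hdA]
    rfl
  have t0 : Fin.tail (Pi.single 0 1 : Fin (d + 1) → ℂ) = 0 := by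
    ext k
    simp [Fin.tail]
  have ts : ∀ l : Fin d, Fin.tail (Pi.single l.succ 1 : Fin (d + 1) → ℂ) = Pi.single l 1 := by
    intro l
    ext k
    simp [Fin.tail, Pi.single_apply]
  rw [ContinuousLinearMap.det, ContinuousLinearMap.det, ← LinearMap.det_toMatrix',
    ← LinearMap.det_toMatrix', Matrix.det_succ_column_zero, Fin.sum_univ_succ,
    Finset.sum_eq_zero fun k _ => by rw [hX, hs, t0, map_zero, mul_zero, zero_mul], hX, h00,
    add_zero, Fin.val_zero, pow_zero, one_mul]
  congr 2
  ext k l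
  rw [Matrix.submatrix_apply, Fin.succAbove_zero, hX, hs, ts, hA]

/-- The relation `-2 K = 4 τ - 2 L - 2 K_A` for `ℙ(𝒪 ⊕ L)` over `A`, on the level of cocycles. -/
lemma canonical_projBundle_sq (L : LineBundle A) (x y : (projBundle L).ι) {p : Fin (d + 1) → ℂ}
    (hp : p ∈ (projBundle L).V x y) :
    ((LineBundle.canonical (projBundle L)).power (-2)).g x y p =
      tautCocycle (L.g x.1 y.1 (Fin.tail p)) x.2 y.2 (p 0) ^ 4 *
        (L.g x.1 y.1 (Fin.tail p) ^ 2)⁻¹ *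
        ((LineBundle.canonical A).power (-2)).g x.1 y.1 (Fin.tail p) := by
  obtain ⟨ε, hε, h⟩ := hasDerivAt_fibreChange _ x.2 y.2 hp.2 (L.ne_zero x.1 y.1 _ hp.1)
  simp only [LineBundle.power, LineBundle.canonical, zpow_neg, inv_zpow, inv_inv]
  rw [det_fderiv_projBundle L x y hp, h.deriv]
  simp only [zpow_ofNat, mul_pow, hε]
  ring

end Jacobian

/-! ### Comparing polynomials on the torus -/

/-- The character `p ↦ ∏ pₖ ^ mₖ` of the torus, for an integer vector `m`. -/
def torusChar {d : ℕ} (m : Fin d → ℤ) : (Fin d → ℂˣ) →* ℂ where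
  toFun p := ∏ k, (p k : ℂ) ^ m k
  map_one' := by simp
  map_mul' p q := by simp [mul_zpow, Finset.prod_mul_distrib]

lemma torusChar_injective (d : ℕ) :
    Function.Injective (torusChar : (Fin d → ℤ) → ((Fin d → ℂˣ) →* ℂ)) := by
  intro m m' h
  ext i
  have h2 := DFunLike.congr_fun h (Pi.mulSingle i (Units.mk0 2 two_ne_zero))
  have key : ∀ m : Fin d → ℤ,
      torusChar m (Pi.mulSingle i (Units.mk0 2 two_ne_zero)) = (2 : ℂ) ^ m i := by
    intro m
    change ∏ k : Fin d, _ = _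
    rw [Finset.prod_eq_single i]
    · simp
    · intro k _ hk
      simp [Pi.mulSingle_eq_of_ne hk]
    · simp
  rw [key, key] at h2
  have h3 : (2 : ℝ) ^ m i = (2 : ℝ) ^ m' i := by
    apply Complex.ofReal_injective
    push_cast
    exact h2
  exact zpow_right_injective₀ (by norm_num) (by norm_num) h3

/-- Independence of characters: if two Laurent polynomials agree on the torus, then every exponent
that occurs on the right also occurs on the left. The maps `f` and `g` describe the exponents that
the monomials of `Q` and `P` get on the torus; as `g` is injective, no terms of `P` cancel. -/
lemma exists_exponent_of_eq_on_torus {d : ℕ} {P Q : MvPolynomial (Fin d) ℂ}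
    {f g : (Fin d →₀ ℕ) → Fin d → ℤ} (hg : Function.Injective g)
    (h : ∀ p : Fin d → ℂˣ, ∑ e ∈ Q.support, coeff e Q * ∏ k, (p k : ℂ) ^ f e k =
      ∑ e ∈ P.support, coeff e P * ∏ k, (p k : ℂ) ^ g e k)
    {e : Fin d →₀ ℕ} (he : coeff e P ≠ 0) : ∃ e', f e' = g e := by
  have hli : LinearIndependent ℂ
      (fun m : Fin d → ℤ => (torusChar m : (Fin d → ℂˣ) → ℂ)) :=
    (linearIndependent_monoidHom (Fin d → ℂˣ) ℂ).comp _ (torusChar_injective d)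
  have heq : ∑ e ∈ Q.support, Finsupp.single (f e) (coeff e Q) =
      ∑ e ∈ P.support, Finsupp.single (g e) (coeff e P) := by
    apply hli
    ext p
    simpa [torusChar] using h p
  by_contra! hne
  have h1 := DFunLike.congr_fun heq (g e)
  rw [Finsupp.finsetSum_apply, Finsupp.finsetSum_apply,
    Finset.sum_eq_zero fun e' _ => Finsupp.single_eq_of_ne (hne e').symm,
    Finset.sum_eq_single e (fun e' _ hee => Finsupp.single_eq_of_ne fun h => hee (hg h).symm)
      fun hh => by simpa using hh, Finsupp.single_eq_same] at h1
  exact he h1.symm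

/-! ### Multiplicity along a coordinate line of affine space -/

/-- The restriction of polynomials on `𝔸³` to the line `x₀ = x₁ = 0`. -/
def restrictLine : MvPolynomial (Fin 3) ℂ →ₐ[ℂ] Polynomial ℂ :=
  aeval ![0, 0, Polynomial.X]

/-- The restriction of polynomials on `𝔸³` to the plane `x₁ = 0`, as polynomials in `x₀` over
`ℂ[x₂]`. -/
def restrictPlane : MvPolynomial (Fin 3) ℂ →ₐ[ℂ] Polynomial (Polynomial ℂ) :=
  aeval ![Polynomial.X, 0, Polynomial.C Polynomial.X]

lemma coeff_zero_restrictPlane (f : MvPolynomial (Fin 3) ℂ) :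
    (restrictPlane f).coeff 0 = restrictLine f := by
  induction f using MvPolynomial.induction_on with
  | C a =>
    simp only [restrictPlane, restrictLine, algHom_C]
    exact Polynomial.coeff_C_zero
  | add f g hf hg => simp [hf, hg]
  | mul_X f i hf =>
    rw [map_mul, map_mul, Polynomial.mul_coeff_zero, hf]
    congr 1
    fin_cases i <;> simp [restrictPlane, restrictLine]

lemma coeff_coeff_restrictPlane (f : MvPolynomial (Fin 3) ℂ) (a c : ℕ) :
    ((restrictPlane f).coeff a).coeff c =
      coeff (Finsupp.single 0 a + Finsupp.single 2 c) f := by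
  induction f using MvPolynomial.induction_on' with
  | add f g hf hg => simp [hf, hg]
  | monomial e r =>
    have h1 : restrictPlane (monomial e r) =
        Polynomial.C (Polynomial.C r * 0 ^ e 1 * Polynomial.X ^ e 2) * Polynomial.X ^ e 0 := by
      rw [restrictPlane, aeval_monomial, Finsupp.prod_fintype _ _ fun _ => pow_zero _,
        Fin.prod_univ_three]
      change Polynomial.C (Polynomial.C r) * _ = _
      simp
      ring
    have h2 : e = Finsupp.single 0 a + Finsupp.single 2 c ↔ e 0 = a ∧ e 1 = 0 ∧ e 2 = c := by
      rw [DFunLike.ext_iff, Fin.forall_fin_succ, Fin.forall_fin_two]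
      simp
    rw [h1, Polynomial.coeff_C_mul_X_pow, coeff_monomial]
    simp only [h2]
    by_cases ha : e 0 = a
    · by_cases hb : e 1 = 0
      · simp [ha, hb, Polynomial.coeff_X_pow, eq_comm]
      · simp [hb]
    · simp [ha, Ne.symm ha]

lemma vanishingIdeal_line :
    vanishingIdeal ℂ {p : Fin 3 → ℂ | p 0 = 0 ∧ p 1 = 0} = RingHom.ker restrictLine := by
  have key : ∀ (c : ℂ) (f : MvPolynomial (Fin 3) ℂ),
      (restrictLine f).eval c = aeval ![0, 0, c] f := by
    intro c f
    have : ((Polynomial.aeval c).comp restrictLine) = aeval ![0, 0, c] := by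
      ext i
      fin_cases i <;> simp [restrictLine]
    rw [← this]
    simp
  ext f
  rw [mem_vanishingIdeal_iff, RingHom.mem_ker]
  constructor
  · intro h
    refine Polynomial.funext fun c => ?_
    rw [key, Polynomial.eval_zero]
    exact h _ ⟨rfl, rfl⟩
  · rintro h p ⟨h0, h1⟩
    have hp : p = ![0, 0, p 2] := by
      ext i
      fin_cases i <;> simp [h0, h1]
    rw [hp, ← key, h, Polynomial.eval_zero]

lemma X_mem_ker_restrictLine {k : Fin 3} (hk : k ≠ 2) :
    (X k : MvPolynomial (Fin 3) ℂ) ∈ RingHom.ker restrictLine := by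
  rw [RingHom.mem_ker]
  fin_cases k <;> simp_all [restrictLine]

lemma mem_pow_ker_restrictLine {f : MvPolynomial (Fin 3) ℂ} {m : ℕ}
    (h : ∀ e : Fin 3 →₀ ℕ, e 0 + e 1 < m → coeff e f = 0) :
    f ∈ RingHom.ker restrictLine ^ m := by
  rw [f.as_sum]
  refine Ideal.sum_mem _ fun e he => ?_
  have hm : m ≤ e 0 + e 1 := not_lt.1 fun hlt => (mem_support_iff.1 he) (h e hlt)
  rw [monomial_eq, Finsupp.prod_fintype _ _ fun _ => pow_zero _, Fin.prod_univ_three]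
  refine Ideal.mul_mem_left _ _ (Ideal.mul_mem_right _ _ (Ideal.pow_le_pow_right hm ?_))
  rw [pow_add]
  exact Ideal.mul_mem_mul (Ideal.pow_mem_pow (X_mem_ker_restrictLine (by decide)) _)
    (Ideal.pow_mem_pow (X_mem_ker_restrictLine (by decide)) _)

lemma X_pow_dvd_restrictPlane {f : MvPolynomial (Fin 3) ℂ} {m : ℕ}
    (hf : f ∈ RingHom.ker restrictLine ^ m) : Polynomial.X ^ m ∣ restrictPlane f := by
  have h1 : Ideal.map restrictPlane (RingHom.ker restrictLine) ≤ Ideal.span {Polynomial.X} := by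
    rw [Ideal.map_le_iff_le_comap]
    intro g hg
    rw [Ideal.mem_comap, Ideal.mem_span_singleton, Polynomial.X_dvd_iff,
      coeff_zero_restrictPlane]
    exact hg
  have h2 := Ideal.mem_map_of_mem restrictPlane hf
  rw [Ideal.map_pow] at h2
  rw [← Ideal.mem_span_singleton, ← Ideal.span_singleton_pow]
  exact Ideal.pow_right_mono h1 m h2

/-- A product `t * f` with `t` not vanishing on the line lies in the `(m+1)`-st power of the ideal
of the line only if the pure `x₀ ^ m`-part of `f` vanishes. -/
lemma mul_notMem_pow_ker_restrictLine {f t : MvPolynomial (Fin 3) ℂ} {m : ℕ}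
    (hf : f ∈ RingHom.ker restrictLine ^ m) (hm : (restrictPlane f).coeff m ≠ 0)
    (ht : t ∉ RingHom.ker restrictLine) : t * f ∉ RingHom.ker restrictLine ^ (m + 1) := by
  intro h
  obtain ⟨g, hg⟩ := X_pow_dvd_restrictPlane hf
  have h1 := X_pow_dvd_restrictPlane h
  rw [map_mul, hg, mul_left_comm, pow_succ] at h1
  have h2 := (mul_dvd_mul_iff_left (pow_ne_zero m Polynomial.X_ne_zero)).1 h1
  rcases Polynomial.prime_X.dvd_or_dvd h2 with h3 | h3
  · rw [Polynomial.X_dvd_iff, coeff_zero_restrictPlane] at h3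
    exact ht h3
  · rw [Polynomial.X_dvd_iff] at h3
    apply hm
    rw [hg, Polynomial.coeff_X_pow_mul', if_pos le_rfl, Nat.sub_self, h3]

/-- The local multiplicity along the line `x₀ = x₁ = 0` is read off from the exponents. -/
lemma multiplicity_line {f : MvPolynomial (Fin 3) ℂ} {m c : ℕ}
    (h : ∀ e : Fin 3 →₀ ℕ, e 0 + e 1 < m → coeff e f = 0)
    (hc : coeff (Finsupp.single 0 m + Finsupp.single 2 c) f ≠ 0)
    {I : Ideal (MvPolynomial (Fin 3) ℂ)} [hI : I.IsPrime]
    (hIe : I = vanishingIdeal ℂ {p : Fin 3 → ℂ | p 0 = 0 ∧ p 1 = 0}) :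
    algebraMap _ (Localization.AtPrime I) f ∈
        IsLocalRing.maximalIdeal (Localization.AtPrime I) ^ m ∧
      algebraMap _ (Localization.AtPrime I) f ∉
        IsLocalRing.maximalIdeal (Localization.AtPrime I) ^ (m + 1) := by
  rw [vanishingIdeal_line] at hIe
  have hf := mem_pow_ker_restrictLine h
  rw [← Localization.AtPrime.map_eq_maximalIdeal, ← Ideal.map_pow, ← Ideal.map_pow]
  refine ⟨Ideal.mem_map_of_mem _ (hIe ▸ hf), fun hmem => ?_⟩
  rw [IsLocalization.algebraMap_mem_map_algebraMap_iff I.primeCompl] at hmem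
  obtain ⟨t, ht, htf⟩ := hmem
  have hm : (restrictPlane f).coeff m ≠ 0 := by
    intro h0
    rw [← coeff_coeff_restrictPlane, h0, Polynomial.coeff_zero] at hc
    exact hc rfl
  subst hIe
  exact mul_notMem_pow_ker_restrictLine hf hm ht htf

/-! ### Zeros of sections -/

lemma mem_zeros_chart {d : ℕ} {A : GluedVariety d} {L : LineBundle A} (s : L.H0) (i : A.ι)
    (p : Fin d → ℂ) : A.chart i p ∈ LineBundle.zeros s ↔ eval p (s.1 i) = 0 := by
  constructor
  · rintro ⟨j, q, hq, h0⟩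
    obtain ⟨hp, hφ⟩ : p ∈ A.V i j ∧ A.φ i j p = q := Quotient.exact hq
    have h := s.2 i j p hp
    rw [hφ, h0, eq_comm, mul_eq_zero] at h
    exact h.resolve_left (L.ne_zero i j p hp)
  · exact fun h => ⟨i, p, rfl, h⟩

lemma GluedVariety.exists_chart {d : ℕ} {A : GluedVariety d} (z : A.Point) :
    ∃ i p, z = A.chart i p := by
  induction z using Quotient.inductionOn with
  | h x => exact ⟨x.1, x.2, rfl⟩

/-- The curve `σ` does not meet the charts other than `(a, true, false)`, and is the line
`x₀ = x₁ = 0` in these. -/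
lemma chart_mem_sigma (n : ℕ) (a b c : Bool) (p : Fin 3 → ℂ) :
    (threefold n).chart ((((), a), b), c) p ∈ sigma n ↔
      b = true ∧ c = false ∧ p 0 = 0 ∧ p 1 = 0 := by
  have hR : (threefold n).chart ((((), a), b), c) p ∈ surfaceR n ↔ _ := mem_zeros_chart _ _ _
  have hU : (threefold n).chart ((((), a), b), c) p ∈ surfaceU n ↔ _ := mem_zeros_chart _ _ _
  rw [sigma, Set.mem_inter_iff, hR, hU]
  simp only [sectionR, pullbackSection, Hirzebruch.sectionC0, sectionT, eval_rename]
  cases b <;> cases c <;> simp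

/-! ### The cocycle of the bianticanonical bundle and its monomial sections -/

lemma canonical_point_g (i j : point.ι) (p : Fin 0 → ℂ) :
    ((LineBundle.canonical point).power (-2)).g i j p = 1 := by
  have h : ∀ f : (Fin 0 → ℂ) →L[ℂ] (Fin 0 → ℂ), f.det = 1 := fun f => by
    rw [ContinuousLinearMap.det, ← LinearMap.det_toMatrix', Matrix.det_isEmpty]
  simp [LineBundle.power, LineBundle.canonical, h]

section Cocycles

variable (n : ℕ) (x y : (threefold n).ι) (p : Fin 3 → ℂ)

/-- The cocycle of `𝒪(F)` on the threefold. -/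
def gF : ℂ := tautCocycle 1 x.1.1.2 y.1.1.2 (p 2)

/-- The cocycle of `𝒪(C₀)` on the threefold. -/
def gC : ℂ := tautCocycle (gF n x y p ^ (-n : ℤ)) x.1.2 y.1.2 (p 1)

/-- The cocycle of `𝒪(τ)` on the threefold. -/
def gT : ℂ :=
  tautCocycle (gC n x y p ^ (-2 : ℤ) * gF n x y p) x.2 y.2 (p 0)

lemma threefold_φ_zero : (threefold n).φ x y p 0 =
    fibreChange (gC n x y p ^ (-2 : ℤ) * gF n x y p) x.2 y.2 (p 0) := by
  rw [← zpow_one (gF n x y p)]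
  rfl

lemma threefold_φ_one : (threefold n).φ x y p 1 =
    fibreChange (gF n x y p ^ (-n : ℤ)) x.1.2 y.1.2 (p 1) := rfl

lemma threefold_φ_two : (threefold n).φ x y p 2 = fibreChange 1 x.1.1.2 y.1.1.2 (p 2) := rfl

variable {n x y p}

lemma gF_ne_zero (hp : p ∈ (threefold n).V x y) : gF n x y p ≠ 0 :=
  (taut (LineBundle.trivial point)).ne_zero x.1.1 y.1.1 _ hp.1.1

lemma gC_ne_zero (hp : p ∈ (threefold n).V x y) : gC n x y p ≠ 0 :=
  (Hirzebruch.OC0 n).ne_zero x.1 y.1 _ hp.1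

/-- Iterating the formula for the canonical bundle of a projective bundle along
`X → 𝔽ₙ → ℙ¹ → pt` gives `-2 K = 4 τ + 8 C₀ + (2 n + 2) F`. -/
lemma bianticanonical_g (hp : p ∈ (threefold n).V x y) :
    (bianticanonical n).g x y p =
      gT n x y p ^ 4 * gC n x y p ^ 8 * gF n x y p ^ (2 * n + 2) := by
  have h1 : (bianticanonical n).g x y p = gT n x y p ^ 4 *
      ((gC n x y p ^ (-2 : ℤ) * gF n x y p) ^ 2)⁻¹ *
      ((LineBundle.canonical (Hirzebruch n)).power (-2)).g x.1 y.1 (Fin.tail p) := by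
    rw [gT, ← zpow_one (gF n x y p)]
    exact canonical_projBundle_sq (Hirzebruch.OnegA n) x y hp
  have h2 : ((LineBundle.canonical (Hirzebruch n)).power (-2)).g x.1 y.1 (Fin.tail p) =
      gC n x y p ^ 4 * ((gF n x y p ^ (-n : ℤ)) ^ 2)⁻¹ *
      ((LineBundle.canonical P1).power (-2)).g x.1.1 y.1.1 (Fin.tail (Fin.tail p)) :=
    canonical_projBundle_sq (P1.O (-n)) x.1 y.1 hp.1
  have h3 : ((LineBundle.canonical P1).power (-2)).g x.1.1 y.1.1 (Fin.tail (Fin.tail p)) =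
      gF n x y p ^ 4 * ((1 : ℂ) ^ 2)⁻¹ * 1 := by
    have h := canonical_projBundle_sq (LineBundle.trivial point) x.1.1 y.1.1 hp.1.1
    rw [canonical_point_g] at h
    exact h
  have hF := gF_ne_zero hp
  have hC := gC_ne_zero hp
  rw [h1, h2, h3, zpow_neg, zpow_neg, zpow_natCast, zpow_ofNat]
  field_simp
  ring

end Cocycles

/-- The exponent of the monomial `a₀ ^ i * a₁ ^ j` in the affine fibre coordinate of the chart `b`,
which is `a₁ / a₀` on the chart `false` and `a₀ / a₁` on the chart `true`. -/
def fibreExponent (b : Bool) (i j : ℕ) : ℕ := if b then i else j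

lemma fibreChange_pow {g : ℂ} (hg : g ≠ 0) (a b : Bool) {w : ℂ} (hw : a ≠ b → w ≠ 0) (i j : ℕ) :
    fibreChange g a b w ^ fibreExponent b i j =
      tautCocycle g a b w ^ (i + j) * (g ^ j)⁻¹ * w ^ fibreExponent a i j := by
  cases a <;> cases b
  · simp [fibreChange, tautCocycle, fibreExponent, mul_pow]
  · have hw := hw (by simp)
    simp only [fibreChange, tautCocycle, fibreExponent, mul_pow, pow_add, inv_pow, if_true]
    field_simp
    simp
  · have hw := hw (by simp)
    simp only [fibreChange, tautCocycle, fibreExponent, mul_pow, pow_add, inv_pow, if_true]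
    field_simp
    simp [mul_comm]
  · simp only [fibreChange, tautCocycle, fibreExponent, mul_pow, pow_add, if_true]
    field_simp

/-- The section of `𝒪(-2K)` given by the monomial `a₀ⁱ a₁ʲ v₀ᵏ v₁ˡ u₀ʳ u₁^q` in the homogeneous
fibre coordinates of `X → 𝔽ₙ → ℙ¹ → pt`. -/
def monomialSection {n i j k l r q : ℕ} (h1 : i + j = 4) (h2 : k + l + 2 * j = 8)
    (h3 : r + q + n * l = 2 * n + 2 + j) : (bianticanonical n).H0 where
  val x := X 0 ^ fibreExponent x.2 i j * X 1 ^ fibreExponent x.1.2 k l *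
    X 2 ^ fibreExponent x.1.1.2 r q
  property := by
    intro x y p hp
    have hF := gF_ne_zero hp
    have hC := gC_ne_zero hp
    have e0 := fibreChange_pow (g := gC n x y p ^ (-2 : ℤ) * gF n x y p)
      (mul_ne_zero (zpow_ne_zero _ hC) hF) (w := p 0) x.2 y.2 hp.2 i j
    have e1 := fibreChange_pow (g := gF n x y p ^ (-n : ℤ)) (zpow_ne_zero _ hF)
      (w := p 1) x.1.2 y.1.2 hp.1.2 k l
    have e2 := fibreChange_pow (g := 1) one_ne_zero (w := p 2) x.1.1.2 y.1.1.2 hp.1.1.2 r q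
    change _ = gT n x y p ^ (i + j) * _ * p 0 ^ _ at e0
    change _ = gC n x y p ^ (k + l) * _ * p 1 ^ _ at e1
    change _ = gF n x y p ^ (r + q) * _ * p 2 ^ _ at e2
    rw [bianticanonical_g hp]
    simp only [map_mul, map_pow, eval_X]
    rw [threefold_φ_zero, threefold_φ_one, threefold_φ_two, e0, e1, e2, h1, ← h2]
    have h4 : gF n x y p ^ (2 * n + 2) * gF n x y p ^ j =
        gF n x y p ^ (r + q) * gF n x y p ^ (n * l) := by
      rw [← pow_add, ← pow_add, h3]
    rw [zpow_neg, zpow_neg, zpow_natCast, zpow_ofNat]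
    simp only [mul_pow, inv_pow, ← pow_mul, one_pow, inv_one, mul_one, inv_inv, mul_inv]
    rw [pow_add _ (k + l)]
    field_simp
    linear_combination -(gT n x y p ^ 4 * p 0 ^ fibreExponent x.2 i j *
      p 1 ^ fibreExponent x.1.2 k l * p 2 ^ fibreExponent x.1.1.2 r q) * h4

lemma eval_monomialSection {n i j k l r q : ℕ} (h1 : i + j = 4) (h2 : k + l + 2 * j = 8)
    (h3 : r + q + n * l = 2 * n + 2 + j) (a b c : Bool) (p : Fin 3 → ℂ) :
    eval p ((monomialSection h1 h2 h3).1 ((((), a), b), c)) =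
      p 0 ^ fibreExponent c i j * p 1 ^ fibreExponent b k l * p 2 ^ fibreExponent a r q := by
  simp only [monomialSection, map_mul, map_pow, eval_X]

/-! ### Vanishing along the curve -/

/-- The comparison of a section over the chart `(a, true, false)` with the opposite chart
`(!a, false, false)`, on their common torus. -/
lemma section_eq_on_torus {n : ℕ} (s : (bianticanonical n).H0) (a : Bool) (p : Fin 3 → ℂˣ) :
    eval ![(p 0 : ℂ) * (p 1 : ℂ) ^ (-2 : ℤ) * p 2, (p 1 : ℂ)⁻¹ * (p 2 : ℂ) ^ (-n : ℤ), (p 2 : ℂ)⁻¹]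
        (s.1 ((((), !a), false), false)) =
      (p 1 : ℂ) ^ (-8 : ℤ) * (p 2 : ℂ) ^ (-(2 * n + 2) : ℤ) *
        eval (fun k => (p k : ℂ)) (s.1 ((((), a), true), false)) := by
  let x : (threefold n).ι := ((((), a), true), false)
  let y : (threefold n).ι := ((((), !a), false), false)
  have hp : (fun k => (p k : ℂ)) ∈ (threefold n).V x y :=
    ⟨⟨⟨trivial, fun _ => (p 2).ne_zero⟩, fun _ => (p 1).ne_zero⟩, fun _ => (p 0).ne_zero⟩
  have hF : gF n x y (fun k => (p k : ℂ)) = (p 2 : ℂ)⁻¹ := by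
    cases a <;> simp [gF, tautCocycle, x, y]
  have hC : gC n x y (fun k => (p k : ℂ)) = (p 1 : ℂ)⁻¹ := by
    simp [gC, tautCocycle, x, y]
  have hT : gT n x y (fun k => (p k : ℂ)) = 1 := by
    simp [gT, tautCocycle, x, y]
  have h := s.2 x y _ hp
  rw [bianticanonical_g hp, hF, hC, hT] at h
  have hφ : (threefold n).φ x y (fun k => (p k : ℂ)) =
      ![(p 0 : ℂ) * (p 1 : ℂ) ^ (-2 : ℤ) * p 2, (p 1 : ℂ)⁻¹ * (p 2 : ℂ) ^ (-n : ℤ),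
        (p 2 : ℂ)⁻¹] := by
    ext k
    fin_cases k
    · refine (threefold_φ_zero n x y _).trans ?_
      rw [hF, hC]
      simp [fibreChange, x, y]
      ring
    · refine (threefold_φ_one n x y _).trans ?_
      rw [hF]
      simp [fibreChange, x, y]
      ring
    · refine (threefold_φ_two n x y _).trans ?_
      cases a <;> simp [fibreChange, x, y]
  rw [hφ] at h
  rw [show (s.1 ((((), !a), false), false)) = s.1 y from rfl, h]
  simp only [one_pow, one_mul, zpow_neg, inv_pow]
  norm_cast

/-- Every section of `𝒪(-2K)` vanishes to order at least `3` along `σ`: a monomial of lower order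
would have a pole along the fibre at infinity. Indeed a monomial of exponents `(A, B, C)` over
`(a, true, false)` has exponents `(A, 8 - 2A - B, 2n + 2 + A - n(8 - 2A - B) - C)` over
`(!a, false, false)`, and the last one is negative if `A + B ≤ 2` and `n ≥ 3`. -/
lemma coeff_section_eq_zero {n : ℕ} (hn : 3 ≤ n) (s : (bianticanonical n).H0) (a : Bool)
    (e : Fin 3 →₀ ℕ) (he : e 0 + e 1 < 3) :
    coeff e (s.1 ((((), a), true), false)) = 0 := by
  by_contra hne
  -- the exponents, in torus coordinates, of the two sides of `section_eq_on_torus`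
  let f : (Fin 3 →₀ ℕ) → Fin 3 → ℤ :=
    fun e => ![e 0, -2 * e 0 - e 1, e 0 - n * e 1 - e 2]
  let g : (Fin 3 →₀ ℕ) → Fin 3 → ℤ := fun e => ![e 0, e 1 - 8, e 2 - (2 * n + 2)]
  have hg : Function.Injective g := by
    intro e e' h
    have h0 := congrFun h 0
    have h1 := congrFun h 1
    have h2 := congrFun h 2
    simp [g] at h0 h1 h2
    ext k
    fin_cases k <;> assumption
  have hfg : ∀ p : Fin 3 → ℂˣ,
      ∑ e ∈ (s.1 ((((), !a), false), false)).support,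
        coeff e (s.1 ((((), !a), false), false)) * ∏ k, (p k : ℂ) ^ f e k =
      ∑ e ∈ (s.1 ((((), a), true), false)).support,
        coeff e (s.1 ((((), a), true), false)) * ∏ k, (p k : ℂ) ^ g e k := by
    intro p
    have hs := section_eq_on_torus s a p
    rw [eval_eq', eval_eq', Finset.mul_sum] at hs
    have h0 := (p 0).ne_zero
    have h1 := (p 1).ne_zero
    have h2 := (p 2).ne_zero
    convert hs using 2 with e _ e _
    · congr 1
      rw [Fin.prod_univ_three, Fin.prod_univ_three]
      simp only [f, Matrix.cons_val, mul_pow, zpow_sub₀ h1, zpow_sub₀ h2, zpow_mul, neg_mul,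
        zpow_neg, zpow_natCast, inv_pow]
      simp only [zpow_ofNat, ← pow_mul]
      field_simp
    · rw [Fin.prod_univ_three, Fin.prod_univ_three]
      simp only [g, Matrix.cons_val, zpow_sub₀ h1, zpow_sub₀ h2, zpow_neg, zpow_natCast]
      ring
  obtain ⟨e', h⟩ := exists_exponent_of_eq_on_torus hg hfg hne
  have h0 : (e' 0 : ℤ) = e 0 := congrFun h 0
  have h1 : (-2 * e' 0 - e' 1 : ℤ) = e 1 - 8 := congrFun h 1
  have h2 : (e' 0 - n * e' 1 - e' 2 : ℤ) = e 2 - (2 * n + 2) := congrFun h 2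
  have h4 : (4 : ℤ) ≤ e' 1 := by omega
  have h5 : (n : ℤ) * 4 ≤ n * e' 1 := mul_le_mul_of_nonneg_left h4 (by positivity)
  omega

/-! ### The base locus and the generic member -/

lemma chart_preimage_sigma (n : ℕ) (a : Bool) :
    (threefold n).chart ((((), a), true), false) ⁻¹' sigma n =
      {p : Fin 3 → ℂ | p 0 = 0 ∧ p 1 = 0} := by
  ext p
  simpa using chart_mem_sigma n a true false p

lemma baseLocus_eq_sigma {n : ℕ} (hn : 3 ≤ n) :
    (bianticanonical n).baseLocus = sigma n := by
  ext z
  obtain ⟨⟨⟨⟨⟨⟩, a⟩, b⟩, c⟩, p, rfl⟩ := GluedVariety.exists_chart z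
  constructor
  · intro h
    have h' : ∀ s : (bianticanonical n).H0, eval p (s.1 ((((), a), b), c)) = 0 :=
      fun s => (mem_zeros_chart s _ p).1 (h s)
    -- the exponents of a section of `𝒪(N F)` that has no zero on the chart `a` of `ℙ¹`
    have hu : ∀ N : ℕ, ∃ r q, r + q = N ∧ fibreExponent a r q = 0 := fun N => by
      cases a
      · exact ⟨N, 0, rfl, rfl⟩
      · exact ⟨0, N, zero_add N, rfl⟩
    rw [chart_mem_sigma]
    -- in each chart, monomials with exponent `0` in all coordinates but at most one cut out `σ`
    cases c
    · cases b
      · obtain ⟨r, q, hrq, h0⟩ := hu (2 * n + 2)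
        have h1 := h' (monomialSection (i := 4) (j := 0) (k := 8) (l := 0) (r := r) (q := q)
          (by norm_num) (by norm_num) (by omega))
        rw [eval_monomialSection, h0] at h1
        simp [fibreExponent] at h1
      · obtain ⟨r, q, hrq, h0⟩ := hu (2 * n + 6)
        obtain ⟨r', q', hrq', h0'⟩ := hu 2
        have h1 := h' (monomialSection (i := 0) (j := 4) (k := 0) (l := 0) (r := r) (q := q)
          (by norm_num) (by norm_num) (by omega))
        have h2 := h' (monomialSection (i := 4) (j := 0) (k := 6) (l := 2) (r := r') (q := q')
          (by norm_num) (by norm_num) (by omega))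
        rw [eval_monomialSection, h0] at h1
        rw [eval_monomialSection, h0'] at h2
        simp only [fibreExponent, pow_zero, mul_one, one_mul, if_true, Bool.false_eq_true,
          if_false] at h1 h2
        exact ⟨rfl, rfl, eq_zero_of_pow_eq_zero h1, eq_zero_of_pow_eq_zero h2⟩
    · obtain ⟨r, q, hrq, h0⟩ := hu (2 * n + 6)
      have h1 := h' (monomialSection (i := 0) (j := 4) (k := 0) (l := 0) (r := r) (q := q)
        (by norm_num) (by norm_num) (by omega))
      rw [eval_monomialSection, h0] at h1
      simp [fibreExponent] at h1
  · intro h s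
    have h1 := h
    rw [chart_mem_sigma] at h1
    obtain ⟨rfl, rfl, hp⟩ := h1
    refine (mem_zeros_chart s _ p).2 ?_
    have h2 : s.1 ((((), a), true), false) ∈ RingHom.ker restrictLine ^ 1 :=
      mem_pow_ker_restrictLine fun e he => coeff_section_eq_zero hn s a e (by omega)
    rw [pow_one, ← vanishingIdeal_line] at h2
    exact h2 p hp

/-- The coefficient of `x₀³` in the local equation over the chart `(a, true, false)`, as a linear
form on the space of sections. -/
def cubicCoeff (n : ℕ) (a : Bool) : Module.Dual ℂ (bianticanonical n).H0 where
  toFun s := coeff (Finsupp.single 0 3) (s.1 ((((), a), true), false))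
  map_add' _ _ := coeff_add _ _ _
  map_smul' _ _ := coeff_smul _ _ _

/-- Two charts meet `σ`, and nonvanishing of the cubic coefficient in each of them bounds the
multiplicity from above. -/
lemma hasMultiplicityAlong_sigma {n : ℕ} (hn : 3 ≤ n) (s : (bianticanonical n).H0)
    (hs : ∀ a, cubicCoeff n a s ≠ 0) : LineBundle.HasMultiplicityAlong s (sigma n) 3 := by
  refine ⟨⟨(threefold n).chart ((((), false), true), false) 0,
    (chart_mem_sigma n _ _ _ _).2 ⟨rfl, rfl, rfl, rfl⟩⟩, ?_⟩
  rintro ⟨⟨⟨⟨⟩, a⟩, b⟩, c⟩ ⟨p, hp⟩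
  obtain ⟨rfl, rfl, -⟩ := (chart_mem_sigma n a b c p).1 hp
  have hI := congrArg (vanishingIdeal ℂ) (chart_preimage_sigma n a)
  have hprime : (vanishingIdeal ℂ
      ((threefold n).chart ((((), a), true), false) ⁻¹' sigma n)).IsPrime := by
    rw [hI, vanishingIdeal_line]
    exact RingHom.ker_isPrime _
  refine ⟨hprime, multiplicity_line (c := 0)
    (fun e he => coeff_section_eq_zero hn s a e he) ?_ hI⟩
  rw [Finsupp.single_zero, add_zero]
  exact hs a

/-- Over the two charts that meet `σ`, the local equation of the section `a₀ a₁³ v₁² (u₀⁵ + u₁⁵)`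
is `x₀³ (1 + x₂⁵)`. -/
lemma exists_cubicCoeff_ne_zero (n : ℕ) :
    ∃ s : (bianticanonical n).H0, ∀ a, cubicCoeff n a s ≠ 0 := by
  let S : (r q : ℕ) → r + q = 5 → (bianticanonical n).H0 := fun r q h =>
    monomialSection (i := 1) (j := 3) (k := 0) (l := 2) (r := r) (q := q)
      (by norm_num) (by norm_num) (by omega)
  have key : ∀ r q h a, cubicCoeff n a (S r q h) = if fibreExponent a r q = 0 then 1 else 0 := by
    intro r q h a
    change coeff (Finsupp.single 0 3) (X 0 ^ 3 * X 1 ^ 0 * X 2 ^ fibreExponent a r q) = _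
    rw [pow_zero, mul_one, X_pow_eq_monomial, X_pow_eq_monomial, monomial_mul, coeff_monomial,
      mul_one]
    congr 1
    simp
  refine ⟨S 0 5 (zero_add 5) + S 5 0 (add_zero 5), fun a => ?_⟩
  rw [map_add, key _ _ (zero_add 5), key _ _ (add_zero 5)]
  cases a <;> simp [fibreExponent]

lemma forGeneric_hasMultiplicityAlong {n : ℕ} (hn : 3 ≤ n) :
    ForGeneric (fun D : (bianticanonical n).LinearSystem =>
      LineBundle.HasMultiplicityAlong D.rep (sigma n) 3) := by
  let F : MvPolynomial (Module.Dual ℂ (bianticanonical n).H0) ℂ :=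
    X (cubicCoeff n false) * X (cubicCoeff n true)
  refine ⟨{D | ∃ G ∈ ({F} : Set _), eval (fun ℓ => ℓ D.rep) G ≠ 0}, ?_,
    ⟨{F}, ?_, rfl⟩, ?_⟩
  · obtain ⟨s, hs⟩ := exists_cubicCoeff_ne_zero n
    have h0 : s ≠ 0 := by
      rintro rfl
      exact hs false (map_zero _)
    obtain ⟨r, hr⟩ := Projectivization.exists_smul_eq_mk_rep ℂ s h0
    refine ⟨Projectivization.mk ℂ s h0, F, rfl, ?_⟩
    rw [← hr]
    simp [F, hs, Units.smul_def]
  · rintro G rfl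
    exact ⟨1 + 1, (isHomogeneous_X _ _).mul (isHomogeneous_X _ _)⟩
  · rintro D ⟨G, rfl, hG⟩
    simp only [F, map_mul, eval_X, mul_ne_zero_iff] at hG
    refine hasMultiplicityAlong_sigma hn _ fun a => ?_
    cases a
    · exact hG.1
    · exact hG.2

end Scroll

end

theorem mainTheorem4 :
    ∃ N₀ : ℕ, ∀ n : ℕ, N₀ ≤ n →
      (Scroll.bianticanonical n).baseLocus = Scroll.sigma n ∧
      Scroll.ForGeneric (fun D : (Scroll.bianticanonical n).LinearSystem =>
        Scroll.LineBundle.HasMultiplicityAlong D.rep (Scroll.bianticanonical n).baseLocus 3) := by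
  refine ⟨3, fun n hn => ⟨Scroll.baseLocus_eq_sigma hn, ?_⟩⟩
  rw [Scroll.baseLocus_eq_sigma hn]
  exact Scroll.forGeneric_hasMultiplicityAlong hn
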